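/- **Corollary (The quantitative wedge-of-the-edge theorem).** A *real operator system* is a real linear subspace $R$, containing $1$, of the self-adjoint elements of a unital $C^*$-algebra $A$. For $n\in\mathbb N$ let $\mathcal M(R)_n=M_n(\mathbb C)\otimes_{\mathbb R}R$, regarded as the space of $n\times n$ matrices with entries in $\mathbb C\otimes R=R+iR\subseteq A$, with the norm and the order inherited from the $C^*$-algebra $M_n(A)$; let $\mathcal M(R)=\bigcup_n\mathcal M(R)_n$ and let $\mathcal S(R)$ be the set of its self-adjoint elements. A *positive contraction* is an element $X$ with $X\ge 0$ and $\|X\|\le 1$. A function $f$ from a set $G\subseteq\mathcal M(R_1)$ to $\mathcal M(R_2)$ is *free* if it maps $G\cap\mathcal M(R_1)_n$ into $\mathcal M(R_2)_n$ and satisfies $f(X\oplus Y)=f(X)\oplus f(Y)$ and $f(S^{-1}XS)=S^{-1}f(X)S$ for invertible complex matrices $S$, whenever all arguments lie in $G$. There are universal constants $\delta,\varepsilon>0$ such that the following two statements hold. 1. *(Commutative case.)* Let $R_1$ be a real operator system and $R_2$ a real linear subspace of a complex Banach space $E$. For each $d\ge 0$ let $h_d:R_1\to R_2$ be a generalized homogeneous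 polynomial of degree $d$, i.e. for all $x_1,\dots,x_k\in R_1$ the function $t\mapsto h_d(\sum_i t_ix_i)$ on $\mathbb R^k$ is a homogeneous polynomial of degree $d$ with vector coefficients. Suppose $\sum_d\|h_d(X)\|\le 1$ for every positive contraction $X\in R_1$. Then each $h_d$ has a unique extension, also denoted $h_d$, to a complex generalized homogeneous polynomial $R_1+iR_1\to E$ of degree $d$. On the ball $B_{\mathbb C}(0,\delta)=\{Z\in R_1+iR_1:\|Z\|<\delta\}$ the series $\sum_d h_d(Z)$ converges absolutely and uniformly, and its sum is a complex analytic function with values in the closed complex span of $R_2$, of norm at most $\varepsilon$. 2. *(Noncommutative case.)* Let $R_1,R_2$ be real operator systems. For each $d\ge 0$ let $h_d:\mathcal M(R_1)\to\mathcal M(R_2)$ be a noncommutative generalized homogeneous polynomial of degree $d$, i.e. a free function such that for all $x_1,\dots,x_k\in R_1$ there are coefficients $c_w\in\mathbb C\otimes R_2$, indexed by the words $w$ of length $d$ in $k$ letters, with $h_d(\sum_iT_i\otimes x_i)=\sum_{|w|=d}T^w\otimes c_w$ for all $n$ and all $T_1,\dots,T_k\in M_n(\mathbb C)$. Suppose $\sum_d\|h_d(X)\|\le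 1$ for every positive contraction $X\in\mathcal S(R_1)$. Then on $B_{\mathbb C}(0,\delta)=\bigcup_n\{Z\in\mathcal M(R_1)_n:\|Z\|<\delta\}$ the series $\sum_d h_d(Z)$ converges absolutely, and uniformly over all $n$ simultaneously, and its sum is a noncommutative analytic function (a free function into $\mathcal M(\overline{R_2})$ that is complex analytic on each level $n$) of norm at most $\varepsilon$. -/

import Mathlib

noncomputable section

namespace WedgeOfEdge

/-- A real operator system in a unital C⋆-algebra `A`: a real subspace of self-adjoint elements
that contains `1`. It need not be closed. -/
structure IsRealOperatorSystem {A : Type*} [CStarAlgebra A] (R : Submodule ℝ A) : Prop where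
  one_mem : (1 : A) ∈ R
  isSelfAdjoint : ∀ x ∈ R, IsSelfAdjoint x

/-- The complex span of a real subspace. If `R` consists of self-adjoint elements, then
`R ∩ iR = 0`, so that this is the complexification `ℂ ⊗ R = R + iR`. -/
def cspan {E : Type*} [NormedAddCommGroup E] [NormedSpace ℂ E] (R : Submodule ℝ E) :
    Submodule ℂ E :=
  Submodule.span ℂ (R : Set E)

/-- The inclusion of `R` into its complexification. -/
def toCspan {E : Type*} [NormedAddCommGroup E] [NormedSpace ℂ E] (R : Submodule ℝ E) (x : R) :
    cspan R :=
  ⟨(x : E), Submodule.subset_span x.2⟩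

/-! ### Commutative polynomials -/

/-- Generalized homogeneous polynomials of degree `d` over `𝕜`: functions whose restriction to
(the span of) any finite family of vectors is a homogeneous polynomial of degree `d` in the
coordinates, with vector coefficients. -/
def IsGenHomPoly (𝕜 : Type*) [Field 𝕜] {V E : Type*} [AddCommGroup V] [Module 𝕜 V]
    [AddCommGroup E] [Module 𝕜 E] (d : ℕ) (h : V → E) : Prop :=
  ∀ (k : ℕ) (x : Fin k → V), ∃ c : (Fin k → ℕ) → E, ∀ t : Fin k → 𝕜,
    h (∑ i, t i • x i) =
      ∑ α ∈ Finset.piAntidiag (Finset.univ : Finset (Fin k)) d, (∏ i, t i ^ α i) • c α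

/-- `H` is the complexification of `h`: a complex generalized homogeneous polynomial of degree `d`
on `R + iR` that agrees with `h` on `R`. -/
structure IsComplexification {A E : Type*} [NormedAddCommGroup A] [NormedSpace ℂ A]
    [NormedAddCommGroup E] [NormedSpace ℂ E] {R : Submodule ℝ A} (d : ℕ)
    (h : R → E) (H : cspan R → E) : Prop where
  isGenHomPoly : IsGenHomPoly ℂ d H
  agree : ∀ x : R, H (toCspan R x) = h x

/-! ### The matrix universe and free functions -/

section Matrices

variable {A : Type*}

/-- The elementary tensor `T ⊗ a`, as the matrix with entries `T i j • a`. -/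
def tens [SMul ℂ A] {n : ℕ} (T : Matrix (Fin n) (Fin n) ℂ) (a : A) :
    CStarMatrix (Fin n) (Fin n) A :=
  CStarMatrix.ofMatrix (T.map fun t => t • a)

/-- The direct sum `X ⊕ Y`, as a block diagonal matrix. -/
def dsum [Zero A] {m n : ℕ} (X : CStarMatrix (Fin m) (Fin m) A)
    (Y : CStarMatrix (Fin n) (Fin n) A) : CStarMatrix (Fin (m + n)) (Fin (m + n)) A :=
  CStarMatrix.ofMatrix (Matrix.reindex finSumFinEquiv finSumFinEquiv
    (Matrix.fromBlocks (CStarMatrix.ofMatrix.symm X) 0 0 (CStarMatrix.ofMatrix.symm Y)))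

/-- The similarity `S⁻¹ X S` by an invertible complex matrix `S`. -/
def conj [CStarAlgebra A] {n : ℕ} (S : GL (Fin n) ℂ) (X : CStarMatrix (Fin n) (Fin n) A) :
    CStarMatrix (Fin n) (Fin n) A :=
  tens ((S⁻¹ : GL (Fin n) ℂ) : Matrix (Fin n) (Fin n) ℂ) 1 * X *
    tens (S : Matrix (Fin n) (Fin n) ℂ) 1

/-- The level `M_n(ℂ) ⊗ R` of the matrix universe over `R`, realized as the space of
`n × n` matrices with entries in `R + iR`. -/
def matUniv [CStarAlgebra A] (R : Submodule ℝ A) (n : ℕ) :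
    Submodule ℂ (CStarMatrix (Fin n) (Fin n) A) where
  carrier := {X | ∀ i j, X i j ∈ cspan R}
  add_mem' := fun hX hY i j => (cspan R).add_mem (hX i j) (hY i j)
  zero_mem' := fun _ _ => (cspan R).zero_mem
  smul_mem' := fun c _ hX i j => (cspan R).smul_mem c (hX i j)

variable {B : Type*}

/-- `f` is a free function on `G ⊆ 𝓜(R₁)` with values in `𝓜(R₂)`. (The values of `f n` outside
`G n` are irrelevant.) -/
structure IsFreeFunction [CStarAlgebra A] [CStarAlgebra B] (R₁ : Submodule ℝ A)
    (R₂ : Submodule ℝ B) (G : ∀ n : ℕ, Set (CStarMatrix (Fin n) (Fin n) A))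
    (f : ∀ n : ℕ, CStarMatrix (Fin n) (Fin n) A → CStarMatrix (Fin n) (Fin n) B) : Prop where
  domain_subset : ∀ n, ∀ X ∈ G n, X ∈ matUniv R₁ n
  maps_to : ∀ n, ∀ X ∈ G n, f n X ∈ matUniv R₂ n
  map_dsum : ∀ m n, ∀ X ∈ G m, ∀ Y ∈ G n, dsum X Y ∈ G (m + n) →
    f (m + n) (dsum X Y) = dsum (f m X) (f n Y)
  map_conj : ∀ n, ∀ X ∈ G n, ∀ S : GL (Fin n) ℂ, conj S X ∈ G n →
    f n (conj S X) = conj S (f n X)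

/-- Noncommutative generalized homogeneous polynomials of degree `d`: free functions on `𝓜(R₁)`
which, for any `x₁, …, x_k ∈ R₁`, are given on `∑ Tᵢ ⊗ xᵢ` by a noncommutative homogeneous
polynomial `∑_{|w| = d} T^w ⊗ c_w` with coefficients `c_w ∈ ℂ ⊗ R₂` that do not depend on the
matrix size. -/
structure IsNCGenHomPoly [CStarAlgebra A] [CStarAlgebra B] (R₁ : Submodule ℝ A)
    (R₂ : Submodule ℝ B) (d : ℕ)
    (h : ∀ n : ℕ, CStarMatrix (Fin n) (Fin n) A → CStarMatrix (Fin n) (Fin n) B) : Prop where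
  free : IsFreeFunction R₁ R₂ (fun n => (matUniv R₁ n : Set _)) h
  poly : ∀ (k : ℕ) (x : Fin k → A), (∀ i, x i ∈ R₁) →
    ∃ c : (Fin d → Fin k) → B, (∀ w, c w ∈ cspan R₂) ∧
      ∀ (n : ℕ) (T : Fin k → Matrix (Fin n) (Fin n) ℂ),
        h n (∑ i, tens (T i) (x i)) =
          ∑ w : Fin d → Fin k, tens (List.ofFn fun j => T (w j)).prod (c w)

variable [CStarAlgebra A] [PartialOrder A] [StarOrderedRing A]

/-- The complex ball `B_ℂ(0, δ)` in `𝓜(R)`, level by level, for the C⋆-norm on matrices. -/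
def ncBall (R : Submodule ℝ A) (δ : ℝ) (n : ℕ) : Set (CStarMatrix (Fin n) (Fin n) A) :=
  {Z | Z ∈ matUniv R n ∧ ‖Z‖ < δ}

/-- The positive contractions in the Hermitian matrix universe `𝓢(R)`, level by level. -/
def ncPosContractions (R : Submodule ℝ A) (n : ℕ) : Set (CStarMatrix (Fin n) (Fin n) A) :=
  {X | X ∈ matUniv R n ∧ 0 ≤ X ∧ ‖X‖ ≤ 1}

/-- A noncommutative analytic function on `G ⊆ 𝓜(R₁)`: a free function that is analytic on each
level, as a function on the complex normed space `M_n(ℂ) ⊗ R₁`. -/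
structure IsNCAnalytic [CStarAlgebra B] [PartialOrder B] [StarOrderedRing B]
    (R₁ : Submodule ℝ A) (R₂ : Submodule ℝ B)
    (G : ∀ n : ℕ, Set (CStarMatrix (Fin n) (Fin n) A))
    (f : ∀ n : ℕ, CStarMatrix (Fin n) (Fin n) A → CStarMatrix (Fin n) (Fin n) B) : Prop where
  free : IsFreeFunction R₁ R₂ G f
  analytic : ∀ n, AnalyticOnNhd ℂ (fun Z : matUniv R₁ n => f n Z) {Z | (Z : CStarMatrix _ _ A) ∈ G n}

end Matrices

end WedgeOfEdge

end

/-!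
The `d`-th finite difference of a homogeneous polynomial of degree `d` does not depend on the base
point. Taken at `0` it computes the polarization; taken at `1 / 2`, whose ball of radius `1 / 2`
among the self-adjoint elements consists of positive contractions, it is controlled by the
hypothesis. As `d ^ d / d! ≤ e ^ d`, the polarization of `h_d` is bounded by `(4 * e) ^ d`. Its
complex multilinear extension to `R + iR` expands into `2 ^ d` terms in the real and imaginary
parts, hence is bounded by `(8 * e) ^ d`, so that the series is dominated by `∑ 2 ^ (-d)` on the
ball of radius `1 / (16 * e)`.

The level `n` of the matrix universe is the complexification of a real operator system, its
self-adjoint part, and the restriction of a noncommutative homogeneous polynomial to it is an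
ordinary one. So the same bounds hold on all levels, with constants independent of `n`.
-/

noncomputable section

namespace WedgeOfEdge

open Finset Complex ComplexStarModule

section Polarization

section InclusionExclusion

variable {ι κ : Type*} [Fintype ι] [DecidableEq ι] [Fintype κ]

theorem sum_neg_one_pow_card_compl_of_forall_mem_insertNone (r : κ → Option ι) :
    ∑ S : Finset ι, (if ∀ j, r j ∈ insertNone S then (-1 : ℤ) ^ #Sᶜ else 0) =
      if ∀ i, ∃ j, r j = some i then 1 else 0 := by
  let missed : Finset ι := {i | ∀ j, r j ≠ some i}
  have mem_powerset_missed (S : Finset ι) :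
      (∀ j, r j ∈ insertNone Sᶜ) ↔ S ∈ missed.powerset := by
    simp only [mem_insertNone, Option.mem_def, mem_compl, mem_powerset, subset_iff, missed,
      mem_filter, mem_univ, true_and]
    exact ⟨fun h i hi j hj => h j i hj hi, fun h j i hj hi => h hi j hj⟩
  have missed_eq_empty : missed = ∅ ↔ ∀ i, ∃ j, r j = some i := by
    simp [missed, filter_eq_empty_iff]
  rw [← Equiv.sum_comp (compl_involutive (α := Finset ι)).toPerm]
  simp only [Function.Involutive.coe_toPerm, compl_compl, mem_powerset_missed,
    ← missed_eq_empty]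
  rw [← sum_filter, filter_mem_eq_inter, univ_inter, sum_powerset_neg_one_pow_card]

theorem sum_filter_forall_exists_eq_some {M : Type*} [AddCommMonoid M] (F : (ι → Option ι) → M) :
    ∑ r with ∀ i, ∃ j, r j = some i, F r = ∑ σ : Equiv.Perm ι, F fun j => some (σ j) := by
  symm
  refine sum_bij (fun σ _ j => some (σ j)) (fun σ _ => ?_) (fun σ _ τ _ h => ?_) (fun r hr => ?_)
    fun _ _ => rfl
  · exact mem_filter.2 ⟨mem_univ _, fun i => ⟨σ.symm i, by simp⟩⟩
  · ext j
    exact Option.some.inj (congrFun h j)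
  · choose preimage hpreimage using (mem_filter.1 hr).2
    have hinj : Function.Injective preimage := fun a b hab =>
      Option.some.inj (by rw [← hpreimage a, hab, hpreimage b])
    let e := Equiv.ofBijective preimage (Finite.injective_iff_bijective.1 hinj)
    refine ⟨e.symm, mem_univ _, funext fun j => ?_⟩
    rw [← hpreimage]
    exact congrArg r (e.apply_symm_apply j)

end InclusionExclusion

variable {𝕜 V E : Type*} [Field 𝕜] [AddCommGroup V] [Module 𝕜 V]
  [AddCommGroup E] [Module 𝕜 E] {d : ℕ}

theorem sum_neg_one_pow_smul_diagonal {ι : Type*} [Fintype ι] [DecidableEq ι]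
    (N : MultilinearMap 𝕜 (fun _ : ι => V) E) (b : V) (x : ι → V) :
    ∑ S : Finset ι, (-1 : ℤ) ^ #Sᶜ • N (fun _ => b + ∑ i ∈ S, x i) =
      (∑ σ : Equiv.Perm ι, N.domDomCongr σ) x := by
  -- In the expansion, `r j = none` means that the `j`-th factor contributes `b`.
  let term (r : ι → Option ι) : E := N fun j => (r j).elim b x
  have expand (S : Finset ι) : N (fun _ => b + ∑ i ∈ S, x i) =
      ∑ r, if ∀ j, r j ∈ insertNone S then term r else 0 := by
    rw [add_sum_eq_sum_insertNone, N.map_sum_finset, ← sum_filter]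
    congr 1
    ext r
    simp
  calc ∑ S : Finset ι, (-1 : ℤ) ^ #Sᶜ • N (fun _ => b + ∑ i ∈ S, x i)
      = ∑ r, (∑ S : Finset ι, if ∀ j, r j ∈ insertNone S then (-1 : ℤ) ^ #Sᶜ else 0) • term r := by
        simp only [expand, smul_sum, sum_smul, ite_smul, smul_ite, smul_zero, zero_smul]
        exact sum_comm
    _ = ∑ r with ∀ i, ∃ j, r j = some i, term r := by
        simp only [sum_neg_one_pow_card_compl_of_forall_mem_insertNone, ite_smul, one_smul,
          zero_smul, sum_filter]
    _ = (∑ σ : Equiv.Perm ι, N.domDomCongr σ) x := by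
        rw [sum_filter_forall_exists_eq_some, _root_.sum_apply]
        rfl

theorem IsGenHomPoly.exists_multilinearMap {h : V → E} (hh : IsGenHomPoly 𝕜 d h)
    {ι : Type*} [Fintype ι] (v : ι → V) :
    ∃ N : MultilinearMap 𝕜 (fun _ : Fin d => ι → 𝕜) E,
      ∀ t, h (Fintype.linearCombination 𝕜 v t) = N fun _ => t := by
  classical
  let e := Fintype.equivFin ι
  obtain ⟨c, hc⟩ := hh _ (v ∘ e.symm)
  have monomial (α : Fin (Fintype.card ι) → ℕ) (hα : ∑ i, α i = d) :
      ∃ m : MultilinearMap 𝕜 (fun _ : Fin d => ι → 𝕜) 𝕜, ∀ t : ι → 𝕜,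
        m (fun _ => t) = ∏ i, t (e.symm i) ^ α i := by
    subst hα
    refine ⟨(MultilinearMap.mkPiAlgebra 𝕜 _ 𝕜).compLinearMap
      fun j => LinearMap.proj (e.symm (finSigmaFinEquiv.symm j).1), fun t => ?_⟩
    simp only [MultilinearMap.compLinearMap_apply, MultilinearMap.mkPiAlgebra_apply,
      LinearMap.proj_apply]
    rw [← Equiv.prod_comp finSigmaFinEquiv]
    simp [Fintype.prod_sigma]
  choose! m hm using monomial
  refine ⟨∑ α ∈ piAntidiag univ d, (m α).smulRight (c α), fun t => ?_⟩
  have hvt : Fintype.linearCombination 𝕜 v t = ∑ i, t (e.symm i) • v (e.symm i) := by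
    rw [Fintype.linearCombination_apply, ← Equiv.sum_comp e.symm]
  refine (congrArg h hvt).trans ((hc _).trans ?_)
  rw [_root_.sum_apply]
  refine sum_congr rfl fun α hα => ?_
  rw [MultilinearMap.smulRight_apply, hm α (by simpa using hα)]

theorem IsGenHomPoly.of_exists_multilinearMap {h : V → E}
    (hN : ∀ (k : ℕ) (v : Fin k → V), ∃ N : MultilinearMap 𝕜 (fun _ : Fin d => Fin k → 𝕜) E,
      ∀ t, h (∑ i, t i • v i) = N fun _ => t) :
    IsGenHomPoly 𝕜 d h := by
  intro k v
  obtain ⟨N, hN⟩ := hN k v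
  let exponent (w : Fin d → Fin k) (i : Fin k) : ℕ := #{j | w j = i}
  let coeff (w : Fin d → Fin k) : E := N fun j => Pi.single (w j) 1
  have exponent_mem (w : Fin d → Fin k) : exponent w ∈ piAntidiag univ d :=
    mem_piAntidiag.2 ⟨by simpa using (card_eq_sum_card_fiberwise (f := w) (s := univ)
      (t := univ) fun _ _ => mem_coe.2 (mem_univ _)).symm, fun i _ => mem_univ i⟩
  have prod_eq (t : Fin k → 𝕜) (w : Fin d → Fin k) : ∏ j, t (w j) = ∏ i, t i ^ exponent w i :=
    (prod_fiberwise' univ w t).symm.trans (by simp [exponent])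
  refine ⟨fun α => ∑ w with exponent w = α, coeff w, fun t => ?_⟩
  calc h (∑ i, t i • v i) = N fun _ => ∑ i, t i • Pi.single i 1 := by
        rw [hN, ← pi_eq_sum_univ']
    _ = ∑ w : Fin d → Fin k, (∏ i, t i ^ exponent w i) • coeff w := by
        rw [N.map_sum]
        exact sum_congr rfl fun w _ => by
          rw [N.map_smul_univ (fun j => t (w j)), prod_eq]
    _ = ∑ α ∈ piAntidiag univ d, ∑ w with exponent w = α, (∏ i, t i ^ exponent w i) • coeff w :=
        (sum_fiberwise_of_maps_to (fun w _ => exponent_mem w) _).symm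
    _ = ∑ α ∈ piAntidiag univ d, (∏ i, t i ^ α i) • ∑ w with exponent w = α, coeff w := by
        refine sum_congr rfl fun α _ => ?_
        rw [smul_sum]
        exact sum_congr rfl fun w hw => by rw [(mem_filter.1 hw).2]

theorem isGenHomPoly_diagonal (N : MultilinearMap 𝕜 (fun _ : Fin d => V) E) :
    IsGenHomPoly 𝕜 d fun x => N fun _ => x :=
  .of_exists_multilinearMap fun _ v =>
    ⟨N.compLinearMap fun _ => Fintype.linearCombination 𝕜 v, fun t => by
      simp [Fintype.linearCombination_apply]⟩

theorem IsGenHomPoly.comp_linearMap {𝕂 U F : Type*} [Field 𝕂] [Algebra 𝕜 𝕂] [AddCommGroup U]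
    [Module 𝕂 U] [Module 𝕜 U] [IsScalarTower 𝕜 𝕂 U] [AddCommGroup F] [Module 𝕂 F] [Module 𝕜 F]
    [IsScalarTower 𝕜 𝕂 F] {h : U → F} (hh : IsGenHomPoly 𝕂 d h) (f : V →ₗ[𝕜] U) :
    IsGenHomPoly 𝕜 d (h ∘ f) := by
  refine .of_exists_multilinearMap fun k v => ?_
  obtain ⟨N, hN⟩ := hh.exists_multilinearMap (f ∘ v)
  refine ⟨(N.restrictScalars 𝕜).compLinearMap fun _ => (Algebra.linearMap 𝕜 𝕂).compLeft (Fin k),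
    fun t => ?_⟩
  refine Eq.trans ?_ (hN (algebraMap 𝕜 𝕂 ∘ t))
  simp [Fintype.linearCombination_apply]

/-- The `d`-th finite difference of `h` at `0` in the directions `x`; for a homogeneous polynomial
of degree `d` it is `d!` times the symmetric multilinear map with diagonal `h`. -/
def polarForm (h : V → E) (x : Fin d → V) : E :=
  ∑ S : Finset (Fin d), (-1 : ℤ) ^ #Sᶜ • h (∑ i ∈ S, x i)

namespace IsGenHomPoly

variable {h : V → E}

theorem exists_multilinearMap_finiteDifference (hh : IsGenHomPoly 𝕜 d h)
    {ι : Type*} [Fintype ι] (v : ι → V) :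
    ∃ N : MultilinearMap 𝕜 (fun _ : Fin d => ι → 𝕜) E, ∀ (b : ι → 𝕜) (a : Fin d → ι → 𝕜),
      ∑ S : Finset (Fin d), (-1 : ℤ) ^ #Sᶜ • h (Fintype.linearCombination 𝕜 v b +
        ∑ i ∈ S, Fintype.linearCombination 𝕜 v (a i)) = N a := by
  obtain ⟨N, hN⟩ := hh.exists_multilinearMap v
  refine ⟨∑ σ : Equiv.Perm (Fin d), N.domDomCongr σ, fun b a => ?_⟩
  simp only [← map_sum, ← map_add, hN]
  exact sum_neg_one_pow_smul_diagonal N b a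

theorem polarForm_eq (hh : IsGenHomPoly 𝕜 d h) (b : V) (x : Fin d → V) :
    polarForm h x = ∑ S : Finset (Fin d), (-1 : ℤ) ^ #Sᶜ • h (b + ∑ i ∈ S, x i) := by
  classical
  obtain ⟨N, hN⟩ := hh.exists_multilinearMap_finiteDifference fun o : Option (Fin d) => o.elim b x
  have at_zero := hN 0 fun i => Pi.single (some i) 1
  have at_b := hN (Pi.single none 1) fun i => Pi.single (some i) 1
  simp only [map_zero, zero_add, Fintype.linearCombination_apply_single, one_smul,
    Option.elim] at at_zero at_b
  rw [polarForm, at_zero, at_b]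

theorem polarForm_update_smul_add_smul (hh : IsGenHomPoly 𝕜 d h) (x : Fin d → V) (i : Fin d)
    (a b : 𝕜) (y z : V) :
    polarForm h (Function.update x i (a • y + b • z)) =
      a • polarForm h (Function.update x i y) + b • polarForm h (Function.update x i z) := by
  let L := Fintype.linearCombination 𝕜 (Sum.elim x ![y, z])
  let coords : Fin d → (Fin d ⊕ Fin 2) → 𝕜 := fun j => Pi.single (.inl j) 1
  obtain ⟨N, hN⟩ := hh.exists_multilinearMap_finiteDifference (Sum.elim x ![y, z])
  have hL (p : (Fin d ⊕ Fin 2) → 𝕜) :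
      polarForm h (Function.update x i (L p)) = N (Function.update coords i p) := by
    have hx : Function.update x i (L p) = fun j => L (Function.update coords i p j) := by
      ext j
      rcases eq_or_ne j i with rfl | hj <;> simp [*, L, coords]
    rw [hx, ← hN 0]
    simp [polarForm, L]
  have hy : y = L (Pi.single (.inr 0) 1) := by simp [L]
  have hz : z = L (Pi.single (.inr 1) 1) := by simp [L]
  rw [hy, hz, ← map_smul, ← map_smul, ← map_add]
  simp only [hL, MultilinearMap.map_update_add, MultilinearMap.map_update_smul]

theorem polarForm_diagonal (hh : IsGenHomPoly 𝕜 d h) (x : V) :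
    polarForm h (fun _ : Fin d => x) = (d.factorial : 𝕜) • h x := by
  obtain ⟨N, hN⟩ := hh.exists_multilinearMap fun _ : Unit => x
  have h_nsmul (m : ℕ) : h (m • x) = N fun _ => m • 1 := by
    rw [← hN, map_nsmul]
    simp [Fintype.linearCombination_apply]
  have h_one : h x = N fun _ => 1 := by simpa using h_nsmul 1
  have key := sum_neg_one_pow_smul_diagonal N 0 1
  simp only [Pi.one_apply, sum_const, zero_add] at key
  simp only [polarForm, sum_const, h_nsmul, key, _root_.sum_apply, h_one]
  simp [MultilinearMap.domDomCongr_apply, Fintype.card_perm, Nat.cast_smul_eq_nsmul, Pi.one_def]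

/-- The symmetric multilinear map with diagonal `h`. This needs `d!` to be invertible in `𝕜`: where
`d! = 0`, it is `0`. -/
def polarization (hh : IsGenHomPoly 𝕜 d h) : MultilinearMap 𝕜 (fun _ : Fin d => V) E :=
  (d.factorial : 𝕜)⁻¹ • MultilinearMap.mk' (polarForm h)
    (fun x i y z => by simpa using hh.polarForm_update_smul_add_smul x i 1 1 y z)
    (fun x i c y => by simpa using hh.polarForm_update_smul_add_smul x i c 0 y 0)

theorem polarization_apply (hh : IsGenHomPoly 𝕜 d h) (x : Fin d → V) :
    hh.polarization x = (d.factorial : 𝕜)⁻¹ • polarForm h x := rfl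

theorem polarization_diagonal [CharZero 𝕜] (hh : IsGenHomPoly 𝕜 d h) (x : V) :
    (hh.polarization fun _ => x) = h x := by
  rw [polarization_apply, hh.polarForm_diagonal,
    inv_smul_smul₀ (Nat.cast_ne_zero.2 d.factorial_ne_zero)]

end IsGenHomPoly

end Polarization

section Bounds

variable {𝕜 V E : Type*} {d : ℕ} {h : V → E} {b : V} {r C : ℝ}

theorem IsGenHomPoly.norm_polarForm_le [Field 𝕜] [SeminormedAddCommGroup V] [Module 𝕜 V]
    [SeminormedAddCommGroup E] [Module 𝕜 E] (hh : IsGenHomPoly 𝕜 d h)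
    (hC : ∀ y ∈ Metric.closedBall b r, ‖h y‖ ≤ C) {x : Fin d → V} (hx : ∑ i, ‖x i‖ ≤ r) :
    ‖polarForm h x‖ ≤ 2 ^ d * C := by
  have norm_term_le (S : Finset (Fin d)) : ‖(-1 : ℤ) ^ #Sᶜ • h (b + ∑ i ∈ S, x i)‖ ≤ C := by
    have hmem : b + ∑ i ∈ S, x i ∈ Metric.closedBall b r := by
      rw [mem_closedBall_iff_norm, add_sub_cancel_left]
      exact (norm_sum_le _ _).trans <| (sum_le_univ_sum_of_nonneg fun _ => norm_nonneg _).trans hx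
    rcases neg_one_pow_eq_or ℤ #Sᶜ with hs | hs <;> simpa [hs] using hC _ hmem
  rw [hh.polarForm_eq b]
  exact (norm_sum_le_of_le _ fun S _ => norm_term_le S).trans_eq (by simp)

theorem norm_multilinearMap_le_of_sum_norm_le [RCLike 𝕜] {ι : Type*} [Fintype ι] {V : ι → Type*}
    [∀ i, NormedAddCommGroup (V i)] [∀ i, NormedSpace 𝕜 (V i)] [NormedAddCommGroup E]
    [NormedSpace 𝕜 E] (N : MultilinearMap 𝕜 V E) (hr : 0 < r)
    (hN : ∀ y : ∀ i, V i, ∑ i, ‖y i‖ ≤ r → ‖N y‖ ≤ C) (x : ∀ i, V i) :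
    ‖N x‖ ≤ C * (Fintype.card ι / r) ^ Fintype.card ι * ∏ i, ‖x i‖ := by
  have hC : 0 ≤ C := (norm_nonneg _).trans (hN 0 (by simpa using hr.le))
  by_cases hx : ∃ i, x i = 0
  · obtain ⟨i, hi⟩ := hx
    rw [N.map_coord_zero i hi, norm_zero]
    positivity
  push Not at hx
  -- Rescale every `x i` to norm `r / card ι`.
  let c (i : ι) : ℝ := Fintype.card ι / r * ‖x i‖
  have card_pos (i : ι) : (0 : ℝ) < Fintype.card ι := Nat.cast_pos.2 (Fintype.card_pos_iff.2 ⟨i⟩)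
  have hc (i : ι) : 0 < c i := mul_pos (div_pos (card_pos i) hr) (norm_pos_iff.2 (hx i))
  let y (i : ι) : V i := (c i : 𝕜)⁻¹ • x i
  have hxy : x = fun i => (c i : 𝕜) • y i :=
    funext fun i => (smul_inv_smul₀ (RCLike.ofReal_ne_zero.2 (hc i).ne') _).symm
  have norm_y (i : ι) : ‖y i‖ = r / Fintype.card ι := by
    have := norm_pos_iff.2 (hx i)
    have := card_pos i
    rw [norm_smul, norm_inv, RCLike.norm_of_nonneg (hc i).le]
    simp only [c]
    field_simp
  have sum_norm_y : ∑ i, ‖y i‖ ≤ r := by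
    simp only [norm_y, sum_const, card_univ, nsmul_eq_mul]
    rcases eq_or_ne (Fintype.card ι : ℝ) 0 with hι | hι
    · simpa [hι] using hr.le
    · exact (mul_div_cancel₀ r hι).le
  calc ‖N x‖ = (∏ i, c i) * ‖N y‖ := by
        rw [hxy, N.map_smul_univ (fun i => (c i : 𝕜)), norm_smul, norm_prod]
        simp only [RCLike.norm_of_nonneg (hc _).le]
    _ ≤ (∏ i, c i) * C :=
        mul_le_mul_of_nonneg_left (hN y sum_norm_y) (prod_nonneg fun i _ => (hc i).le)
    _ = C * (Fintype.card ι / r) ^ Fintype.card ι * ∏ i, ‖x i‖ := by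
        simp only [c, prod_mul_distrib, prod_const, card_univ]
        ring

theorem IsGenHomPoly.norm_polarization_le [RCLike 𝕜] [NormedAddCommGroup V] [NormedSpace 𝕜 V]
    [NormedAddCommGroup E] [NormedSpace 𝕜 E] (hh : IsGenHomPoly 𝕜 d h) (hr : 0 < r)
    (hC : ∀ y ∈ Metric.closedBall b r, ‖h y‖ ≤ C) (x : Fin d → V) :
    ‖hh.polarization x‖ ≤ C * (2 * Real.exp 1 / r) ^ d * ∏ i, ‖x i‖ := by
  have hC₀ : 0 ≤ C := (norm_nonneg _).trans (hC b (Metric.mem_closedBall_self hr.le))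
  have norm_le (y : Fin d → V) (hy : ∑ i, ‖y i‖ ≤ r) :
      ‖hh.polarization y‖ ≤ (d.factorial : ℝ)⁻¹ * (2 ^ d * C) := by
    rw [hh.polarization_apply, norm_smul, norm_inv, RCLike.norm_natCast]
    gcongr
    exact hh.norm_polarForm_le hC hy
  have pow_div_factorial_le : (d : ℝ) ^ d / d.factorial ≤ Real.exp 1 ^ d := by
    rw [← Real.exp_nat_mul, mul_one]
    exact Real.pow_div_factorial_le_exp d (Nat.cast_nonneg d) d
  calc ‖hh.polarization x‖
      ≤ (d.factorial : ℝ)⁻¹ * (2 ^ d * C) * (d / r) ^ d * ∏ i, ‖x i‖ := by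
        simpa using norm_multilinearMap_le_of_sum_norm_le hh.polarization hr norm_le x
    _ = C * (2 / r) ^ d * ((d : ℝ) ^ d / d.factorial) * ∏ i, ‖x i‖ := by ring
    _ ≤ C * (2 / r) ^ d * Real.exp 1 ^ d * ∏ i, ‖x i‖ := by gcongr
    _ = C * (2 * Real.exp 1 / r) ^ d * ∏ i, ‖x i‖ := by
        rw [mul_assoc C, ← mul_pow, div_mul_eq_mul_div]

end Bounds

section PositiveContractions

variable {A : Type*} [CStarAlgebra A] [PartialOrder A] [StarOrderedRing A]

theorem nonneg_and_norm_le_one_of_norm_sub_half_le {a : A} (ha : IsSelfAdjoint a)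
    (hn : ‖a - (1 / 2 : ℝ) • 1‖ ≤ 1 / 2) : 0 ≤ a ∧ ‖a‖ ≤ 1 := by
  have hb : IsSelfAdjoint (a - (1 / 2 : ℝ) • 1) := ha.sub (.smul (.all _) (.one A))
  have norm_le : algebraMap ℝ A ‖a - (1 / 2 : ℝ) • 1‖ ≤ (1 / 2 : ℝ) • 1 :=
    (algebraMap_mono A hn).trans_eq (Algebra.algebraMap_eq_smul_one _)
  have nonneg : 0 ≤ a := by
    simpa using add_le_add_right ((neg_le_neg norm_le).trans hb.neg_algebraMap_norm_le_self)
      ((1 / 2 : ℝ) • (1 : A))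
  refine ⟨nonneg, (CStarAlgebra.norm_le_one_iff_of_nonneg a nonneg).2 ?_⟩
  calc a = (1 / 2 : ℝ) • 1 + (a - (1 / 2 : ℝ) • 1) := by abel
    _ ≤ (1 / 2 : ℝ) • 1 + (1 / 2 : ℝ) • 1 := by
        gcongr
        exact hb.le_algebraMap_norm_self.trans norm_le
    _ = 1 := by rw [← add_smul]; norm_num

theorem IsRealOperatorSystem.norm_polarization_le {R : Submodule ℝ A}
    (hR : IsRealOperatorSystem R) {E : Type*} [NormedAddCommGroup E] [NormedSpace ℝ E] {d : ℕ}
    {h : R → E} (hh : IsGenHomPoly ℝ d h) (hb : ∀ x : R, 0 ≤ (x : A) → ‖x‖ ≤ 1 → ‖h x‖ ≤ 1)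
    (x : Fin d → R) : ‖hh.polarization x‖ ≤ (4 * Real.exp 1) ^ d * ∏ i, ‖x i‖ := by
  have hball (y : R) (hy : y ∈ Metric.closedBall ((1 / 2 : ℝ) • ⟨1, hR.one_mem⟩ : R) (1 / 2)) :
      ‖h y‖ ≤ 1 := by
    obtain ⟨hy₀, hy₁⟩ := nonneg_and_norm_le_one_of_norm_sub_half_le (hR.isSelfAdjoint y y.2)
      (mem_closedBall_iff_norm.1 hy)
    exact hb y hy₀ hy₁
  refine (hh.norm_polarization_le one_half_pos hball x).trans_eq ?_
  ring_nf

end PositiveContractions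

section Complexification

section RealAndImaginaryParts

theorem mem_cspan_of_mem {E : Type*} [NormedAddCommGroup E] [NormedSpace ℂ E] {R : Submodule ℝ E}
    {x : E} (hx : x ∈ R) : x ∈ cspan R :=
  Submodule.subset_span hx

/-- The inclusion `toCspan` as a real linear map. -/
def toCspanₗ {E : Type*} [NormedAddCommGroup E] [NormedSpace ℂ E] (R : Submodule ℝ E) :
    R →ₗ[ℝ] cspan R where
  toFun := toCspan R
  map_add' _ _ := rfl
  map_smul' _ _ := rfl

variable {A : Type*} [NormedAddCommGroup A] [NormedSpace ℂ A] [StarAddMonoid A] [StarModule ℂ A]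
  {R : Submodule ℝ A}

theorem mem_cspan_iff (hR : R ≤ selfAdjoint.submodule ℝ A) {z : A} :
    z ∈ cspan R ↔ (ℜ z : A) ∈ R ∧ (ℑ z : A) ∈ R := by
  refine ⟨fun hz => ?_, fun hz => ?_⟩
  · induction hz using Submodule.span_induction with
    | mem x hx =>
      have hx' : IsSelfAdjoint x := hR hx
      simpa [hx'.coe_realPart, hx'.imaginaryPart] using hx
    | zero => simp
    | add x y _ _ hx hy =>
      simpa using ⟨R.add_mem hx.1 hy.1, R.add_mem hx.2 hy.2⟩
    | smul c x _ hx =>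
      rw [realPart_smul, imaginaryPart_smul]
      exact ⟨R.sub_mem (R.smul_mem _ hx.1) (R.smul_mem _ hx.2),
        R.add_mem (R.smul_mem _ hx.2) (R.smul_mem _ hx.1)⟩
  · rw [← realPart_add_I_smul_imaginaryPart z]
    exact (cspan R).add_mem (mem_cspan_of_mem hz.1) ((cspan R).smul_mem I (mem_cspan_of_mem hz.2))

/-- The real part `R + iR → R`, for a real subspace `R` of self-adjoint elements. -/
def rePart (hR : R ≤ selfAdjoint.submodule ℝ A) : cspan R →ₗ[ℝ] R where
  toFun z := ⟨ℜ (z : A), ((mem_cspan_iff hR).1 z.2).1⟩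
  map_add' _ _ := by ext; simp
  map_smul' _ _ := by ext; simp

/-- The imaginary part `R + iR → R`, for a real subspace `R` of self-adjoint elements. -/
def imPart (hR : R ≤ selfAdjoint.submodule ℝ A) : cspan R →ₗ[ℝ] R where
  toFun z := ⟨ℑ (z : A), ((mem_cspan_iff hR).1 z.2).2⟩
  map_add' _ _ := by ext; simp
  map_smul' _ _ := by ext; simp

variable (hR : R ≤ selfAdjoint.submodule ℝ A)

theorem toCspan_rePart_add_I_smul_imPart (z : cspan R) :
    toCspan R (rePart hR z) + I • toCspan R (imPart hR z) = z :=
  Subtype.ext (realPart_add_I_smul_imaginaryPart (z : A))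

theorem rePart_I_smul (z : cspan R) : rePart hR (I • z) = -imPart hR z := by
  ext; simp [rePart, imPart]

theorem imPart_I_smul (z : cspan R) : imPart hR (I • z) = rePart hR z := by
  ext; simp [rePart, imPart]

theorem rePart_toCspan (x : R) : rePart hR (toCspan R x) = x :=
  Subtype.ext (IsSelfAdjoint.coe_realPart (hR x.2))

theorem imPart_toCspan (x : R) : imPart hR (toCspan R x) = 0 :=
  Subtype.ext (congrArg (Subtype.val : selfAdjoint A → A) (IsSelfAdjoint.imaginaryPart (hR x.2)))

theorem norm_rePart_le [NormedStarGroup A] (z : cspan R) : ‖rePart hR z‖ ≤ ‖z‖ :=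
  realPart.norm_le (z : A)

theorem norm_imPart_le [NormedStarGroup A] (z : cspan R) : ‖imPart hR z‖ ≤ ‖z‖ :=
  imaginaryPart.norm_le (z : A)

end RealAndImaginaryParts

section MultilinearMap

variable {A E ι : Type*} [NormedAddCommGroup A] [NormedSpace ℂ A] [StarAddMonoid A]
  [StarModule ℂ A] {R : Submodule ℝ A}

section Expansion

variable [AddCommGroup E] [Module ℂ E]

theorem multilinearMap_eq_sum_I_pow_smul [Fintype ι] [DecidableEq ι]
    (hR : R ≤ selfAdjoint.submodule ℝ A) (N : MultilinearMap ℂ (fun _ : ι => cspan R) E)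
    (z : ι → cspan R) :
    N z = ∑ S : Finset ι, I ^ #S •
      N (toCspan R ∘ S.piecewise (imPart hR ∘ z) (rePart hR ∘ z)) := by
  have hz : z = (fun i => I • toCspan R (imPart hR (z i))) + fun i => toCspan R (rePart hR (z i)) :=
    funext fun i => by rw [Pi.add_apply, add_comm, toCspan_rePart_add_I_smul_imPart]
  refine (congrArg N hz).trans ((N.map_add_univ _ _).trans (sum_congr rfl fun S _ => ?_))
  rw [← prod_const, ← N.map_piecewise_smul (fun _ => I)]
  congr 1
  ext i
  by_cases hi : i ∈ S <;> simp [hi]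

variable [Finite ι] {N N' : MultilinearMap ℂ (fun _ : ι => cspan R) E}

theorem multilinearMap_mem_of_forall_toCspan_mem (hR : R ≤ selfAdjoint.submodule ℝ A)
    {S : Submodule ℂ E} (hN : ∀ x : ι → R, N (toCspan R ∘ x) ∈ S) (z : ι → cspan R) : N z ∈ S := by
  classical
  have := Fintype.ofFinite ι
  rw [multilinearMap_eq_sum_I_pow_smul hR]
  exact S.sum_mem fun T _ => S.smul_mem _ (hN _)

theorem multilinearMap_ext_toCspan (hR : R ≤ selfAdjoint.submodule ℝ A)
    (hN : ∀ x : ι → R, N (toCspan R ∘ x) = N' (toCspan R ∘ x)) : N = N' := by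
  classical
  have := Fintype.ofFinite ι
  ext z
  rw [multilinearMap_eq_sum_I_pow_smul hR N, multilinearMap_eq_sum_I_pow_smul hR N']
  simp only [hN]

end Expansion

theorem norm_multilinearMap_le_of_forall_toCspan [Fintype ι] [NormedStarGroup A]
    [NormedAddCommGroup E] [NormedSpace ℂ E] (hR : R ≤ selfAdjoint.submodule ℝ A)
    {N : MultilinearMap ℂ (fun _ : ι => cspan R) E} {C : ℝ} (hC : 0 ≤ C)
    (hN : ∀ x : ι → R, ‖N (toCspan R ∘ x)‖ ≤ C * ∏ i, ‖x i‖) (z : ι → cspan R) :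
    ‖N z‖ ≤ 2 ^ Fintype.card ι * C * ∏ i, ‖z i‖ := by
  classical
  have norm_term_le (S : Finset ι) :
      ‖I ^ #S • N (toCspan R ∘ S.piecewise (imPart hR ∘ z) (rePart hR ∘ z))‖ ≤
        C * ∏ i, ‖z i‖ := by
    rw [norm_smul, norm_pow, norm_I, one_pow, one_mul]
    refine (hN _).trans ?_
    gcongr with i
    by_cases hi : i ∈ S
    · simpa [hi] using norm_imPart_le hR (z i)
    · simpa [hi] using norm_rePart_le hR (z i)
  rw [multilinearMap_eq_sum_I_pow_smul hR]
  exact (norm_sum_le_of_le _ fun S _ => norm_term_le S).trans_eq (by simp [mul_assoc])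

section Extension

variable [AddCommGroup E] [Module ℂ E] [DecidableEq ι]

theorem smul_eq_re_smul_add_im_smul_I_smul (c : ℂ) (y : E) :
    c • y = c.re • y + c.im • I • y := by
  rw [← Complex.coe_smul, ← Complex.coe_smul, smul_smul, ← add_smul, re_add_im]

theorem map_update_smul_of_map_update_I_smul {V : ι → Type*} [∀ i, AddCommGroup (V i)]
    [∀ i, Module ℂ (V i)] {N : MultilinearMap ℝ V E}
    (hN : ∀ (z : ∀ i, V i) (j : ι), N (Function.update z j (I • z j)) = I • N z)
    (z : ∀ i, V i) (j : ι) (c : ℂ) (y : V j) :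
    N (Function.update z j (c • y)) = c • N (Function.update z j y) := by
  have hI : N (Function.update z j (I • y)) = I • N (Function.update z j y) := by
    simpa using hN (Function.update z j y) j
  rw [smul_eq_re_smul_add_im_smul_I_smul, N.map_update_add, N.map_update_smul, N.map_update_smul,
    hI, ← smul_eq_re_smul_add_im_smul_I_smul]

variable [Fintype ι]

/-- The real multilinear map underlying `complexify`: the formal expansion of `M` at the tuple
`re zᵢ + I • im zᵢ`. -/
def complexifyReal (hR : R ≤ selfAdjoint.submodule ℝ A)
    (M : MultilinearMap ℝ (fun _ : ι => R) E) : MultilinearMap ℝ (fun _ : ι => cspan R) E :=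
  ∑ S : Finset ι,
    (I ^ #S : ℂ) • M.compLinearMap (S.piecewise (fun _ => imPart hR) fun _ => rePart hR)

theorem complexifyReal_apply (hR : R ≤ selfAdjoint.submodule ℝ A)
    (M : MultilinearMap ℝ (fun _ : ι => R) E) (z : ι → cspan R) :
    complexifyReal hR M z =
      ∑ S : Finset ι, I ^ #S • M (S.piecewise (imPart hR ∘ z) (rePart hR ∘ z)) := by
  simp only [complexifyReal, _root_.sum_apply, smul_apply, MultilinearMap.compLinearMap_apply]
  refine sum_congr rfl fun S _ => congrArg (_ • M ·) (funext fun i => ?_)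
  by_cases hi : i ∈ S <;> simp [hi]

theorem complexifyReal_update_I_smul (hR : R ≤ selfAdjoint.submodule ℝ A)
    (M : MultilinearMap ℝ (fun _ : ι => R) E) (z : ι → cspan R) (j : ι) :
    complexifyReal hR M (Function.update z j (I • z j)) = I • complexifyReal hR M z := by
  let value (z : ι → cspan R) (S : Finset ι) : E :=
    M (S.piecewise (imPart hR ∘ z) (rePart hR ∘ z))
  let z' := Function.update z j (I • z j)
  have value_insert {S : Finset ι} (hj : j ∉ S) : value z' (insert j S) = value z S := by
    refine congrArg M (funext fun i => ?_)
    rcases eq_or_ne i j with rfl | hi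
    · simp [z', hj, imPart_I_smul]
    · by_cases hiS : i ∈ S <;> simp [z', hi, hiS]
  have value_of_notMem {S : Finset ι} (hj : j ∉ S) : value z' S = -value z (insert j S) := by
    let w := (insert j S).piecewise (imPart hR ∘ z) (rePart hR ∘ z)
    have hw : S.piecewise (imPart hR ∘ z') (rePart hR ∘ z') = Function.update w j (-w j) := by
      ext1 i
      rcases eq_or_ne i j with rfl | hi
      · simp [z', w, hj, rePart_I_smul]
      · by_cases hiS : i ∈ S <;> simp [z', w, hi, hiS]
    exact (congrArg M hw).trans (by rw [M.map_update_neg, Function.update_eq_self])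
  -- Multiplication by `I` swaps the real and imaginary parts at `j`, that is, `S` and `S ∆ {j}`.
  rw [complexifyReal_apply, complexifyReal_apply, smul_sum,
    ← Equiv.sum_comp (symmDiff_left_involutive {j}).toPerm]
  refine sum_congr rfl fun S _ => ?_
  change I ^ #(symmDiff S {j}) • value z' (symmDiff S {j}) = I • I ^ #S • value z S
  by_cases hj : j ∈ S
  · obtain ⟨T, hjT, rfl⟩ : ∃ T, j ∉ T ∧ insert j T = S :=
      ⟨S.erase j, notMem_erase j S, insert_erase hj⟩
    have : symmDiff (insert j T) {j} = T := by grind [mem_symmDiff]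
    rw [this, value_of_notMem hjT, card_insert_of_notMem hjT, pow_succ', smul_smul, ← mul_assoc,
      I_mul_I, neg_one_mul, neg_smul, smul_neg]
  · have : symmDiff S {j} = insert j S := by grind [mem_symmDiff]
    rw [this, value_insert hj, card_insert_of_notMem hj, pow_succ', smul_smul]

/-- The complex multilinear extension to `R + iR` of a real multilinear map on `R`. -/
def complexify (hR : R ≤ selfAdjoint.submodule ℝ A) (M : MultilinearMap ℝ (fun _ : ι => R) E) :
    MultilinearMap ℂ (fun _ : ι => cspan R) E :=
  MultilinearMap.mk' (complexifyReal hR M) (complexifyReal hR M).map_update_add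
    (map_update_smul_of_map_update_I_smul (complexifyReal_update_I_smul hR M))

theorem complexify_toCspan (hR : R ≤ selfAdjoint.submodule ℝ A)
    (M : MultilinearMap ℝ (fun _ : ι => R) E) (x : ι → R) :
    complexify hR M (toCspan R ∘ x) = M x := by
  refine (complexifyReal_apply hR M _).trans ?_
  rw [Fintype.sum_eq_single ∅]
  · simp [Function.comp_def, rePart_toCspan]
  · intro S hS
    obtain ⟨i, hi⟩ := nonempty_iff_ne_empty.2 hS
    rw [M.map_coord_zero i (by simp [hi, imPart_toCspan]), smul_zero]

end Extension

end MultilinearMap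

section IsComplexification

variable {A E : Type*} [NormedAddCommGroup A] [NormedSpace ℂ A] [NormedAddCommGroup E]
  [NormedSpace ℂ E] {R : Submodule ℝ A} {d : ℕ} {h : R → E} {H H' : cspan R → E}

theorem IsGenHomPoly.comp_toCspan (hH : IsGenHomPoly ℂ d H) :
    IsGenHomPoly ℝ d fun x => H (toCspan R x) :=
  hH.comp_linearMap (toCspanₗ R)

namespace IsComplexification

theorem isGenHomPoly_real (hH : IsComplexification d h H) : IsGenHomPoly ℝ d h := by
  simpa only [hH.agree] using hH.isGenHomPoly.comp_toCspan

theorem polarization_toCspan (hH : IsComplexification d h H) (x : Fin d → R) :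
    hH.isGenHomPoly.polarization (toCspan R ∘ x) = hH.isGenHomPoly_real.polarization x := by
  have agree_sum (S : Finset (Fin d)) : H (∑ i ∈ S, toCspan R (x i)) = h (∑ i ∈ S, x i) := by
    rw [← hH.agree]
    exact congrArg H (map_sum (toCspanₗ R) x S).symm
  simp only [IsGenHomPoly.polarization_apply, polarForm, Function.comp_apply, agree_sum]
  rw [← Complex.coe_smul]
  simp

variable [StarAddMonoid A] [StarModule ℂ A]

theorem unique (hR : R ≤ selfAdjoint.submodule ℝ A) (hH : IsComplexification d h H)
    (hH' : IsComplexification d h H') : H = H' := by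
  have polarization_eq : hH.isGenHomPoly.polarization = hH'.isGenHomPoly.polarization :=
    multilinearMap_ext_toCspan hR fun x => by rw [hH.polarization_toCspan, hH'.polarization_toCspan]
  ext z
  rw [← hH.isGenHomPoly.polarization_diagonal, polarization_eq, IsGenHomPoly.polarization_diagonal]

theorem mem_of_forall_mem (hR : R ≤ selfAdjoint.submodule ℝ A) (hH : IsComplexification d h H)
    {S : Submodule ℝ E} (hS : ∀ x, h x ∈ S) (z : cspan R) : H z ∈ cspan S := by
  rw [← hH.isGenHomPoly.polarization_diagonal]
  refine multilinearMap_mem_of_forall_toCspan_mem hR (fun x => ?_) _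
  rw [hH.polarization_toCspan, IsGenHomPoly.polarization_apply]
  exact mem_cspan_of_mem (S.smul_mem _ (S.sum_mem fun T _ => zsmul_mem (hS _) _))

end IsComplexification

theorem IsGenHomPoly.existsUnique_isComplexification [StarAddMonoid A] [StarModule ℂ A]
    (hR : R ≤ selfAdjoint.submodule ℝ A) (hh : IsGenHomPoly ℝ d h) :
    ∃! H : cspan R → E, IsComplexification d h H := by
  have complexify_polarization :
      IsComplexification d h fun z => complexify hR hh.polarization fun _ => z :=
    ⟨isGenHomPoly_diagonal _, fun x =>
      (complexify_toCspan hR hh.polarization fun _ => x).trans (hh.polarization_diagonal x)⟩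
  exact ⟨_, complexify_polarization, fun H hH => hH.unique hR complexify_polarization⟩

end IsComplexification

theorem IsRealOperatorSystem.le_selfAdjoint {A : Type*} [CStarAlgebra A] {R : Submodule ℝ A}
    (hR : IsRealOperatorSystem R) : R ≤ selfAdjoint.submodule ℝ A :=
  hR.isSelfAdjoint

section Bound

variable {A E : Type*} [CStarAlgebra A] [PartialOrder A] [StarOrderedRing A]
  [NormedAddCommGroup E] [NormedSpace ℂ E] {R : Submodule ℝ A} {d : ℕ} {h : R → E}
  {H : cspan R → E}

theorem IsComplexification.norm_polarization_le (hH : IsComplexification d h H)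
    (hR : IsRealOperatorSystem R) (hb : ∀ x : R, 0 ≤ (x : A) → ‖x‖ ≤ 1 → ‖h x‖ ≤ 1)
    (z : Fin d → cspan R) :
    ‖hH.isGenHomPoly.polarization z‖ ≤ (8 * Real.exp 1) ^ d * ∏ i, ‖z i‖ := by
  have norm_toCspan_le (x : Fin d → R) : ‖hH.isGenHomPoly.polarization (toCspan R ∘ x)‖ ≤
      (4 * Real.exp 1) ^ d * ∏ i, ‖x i‖ := by
    rw [hH.polarization_toCspan]
    exact hR.norm_polarization_le _ hb x
  refine (norm_multilinearMap_le_of_forall_toCspan hR.le_selfAdjoint (by positivity)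
    norm_toCspan_le z).trans_eq ?_
  rw [Fintype.card_fin, ← mul_pow]
  ring

theorem IsComplexification.exists_continuousMultilinearMap (hH : IsComplexification d h H)
    (hR : IsRealOperatorSystem R) (hb : ∀ x : R, 0 ≤ (x : A) → ‖x‖ ≤ 1 → ‖h x‖ ≤ 1) :
    ∃ M : ContinuousMultilinearMap ℂ (fun _ : Fin d => cspan R) E,
      ‖M‖ ≤ (8 * Real.exp 1) ^ d ∧ ∀ z, H z = M fun _ => z :=
  ⟨hH.isGenHomPoly.polarization.mkContinuous _ (hH.norm_polarization_le hR hb),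
    MultilinearMap.mkContinuous_norm_le _ (by positivity) _,
    fun z => (hH.isGenHomPoly.polarization_diagonal z).symm⟩

theorem exists_continuousMultilinearMap_of_cspan_eq (hR : IsRealOperatorSystem R)
    {S : Submodule ℂ A} (hS : cspan R = S) {f : S → E} (hf : IsGenHomPoly ℂ d f)
    (hb : ∀ x : S, (x : A) ∈ R → 0 ≤ (x : A) → ‖x‖ ≤ 1 → ‖f x‖ ≤ 1) :
    ∃ M : ContinuousMultilinearMap ℂ (fun _ : Fin d => S) E,
      ‖M‖ ≤ (8 * Real.exp 1) ^ d ∧ ∀ z, f z = M fun _ => z := by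
  subst hS
  have hf' : IsComplexification d (fun x => f (toCspan R x)) f := ⟨hf, fun _ => rfl⟩
  exact hf'.exists_continuousMultilinearMap hR fun x h0 h1 => hb (toCspan R x) x.2 h0 h1

end Bound

end Complexification

section PowerSeries

variable {𝕜 V E : Type*} [NontriviallyNormedField 𝕜] [NormedAddCommGroup V] [NormedSpace 𝕜 V]
  [NormedAddCommGroup E] [NormedSpace 𝕜 E] {p : FormalMultilinearSeries 𝕜 V E} {K : ℝ}

theorem norm_apply_diagonal_le_half_pow (hK : 0 < K) {d : ℕ}
    {M : ContinuousMultilinearMap 𝕜 (fun _ : Fin d => V) E} (hM : ‖M‖ ≤ K ^ d) {z : V}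
    (hz : ‖z‖ < (2 * K)⁻¹) : ‖M fun _ => z‖ ≤ (1 / 2) ^ d := by
  calc ‖M fun _ => z‖ ≤ K ^ d * ‖z‖ ^ d := by simpa using M.le_of_opNorm_le hM fun _ => z
    _ ≤ K ^ d * (2 * K)⁻¹ ^ d := by gcongr
    _ = (1 / 2) ^ d := by rw [← mul_pow]; field_simp

theorem analyticOnNhd_tsum_diagonal [CompleteSpace E] (hK : 0 < K) (hp : ∀ d, ‖p d‖ ≤ K ^ d) :
    AnalyticOnNhd 𝕜 (fun z => ∑' d, p d fun _ => z) (Metric.ball 0 K⁻¹) := by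
  have le_radius : ENNReal.ofReal K⁻¹ ≤ p.radius := by
    refine p.le_radius_of_bound 1 fun d => ?_
    rw [Real.coe_toNNReal _ (by positivity)]
    calc ‖p d‖ * K⁻¹ ^ d ≤ K ^ d * K⁻¹ ^ d := by gcongr; exact hp d
      _ = 1 := by rw [← mul_pow, mul_inv_cancel₀ hK.ne', one_pow]
  have radius_pos : 0 < p.radius := (ENNReal.ofReal_pos.2 (inv_pos.2 hK)).trans_le le_radius
  rw [← Metric.eball_ofReal]
  exact (p.hasFPowerSeriesOnBall radius_pos).analyticOnNhd.mono
    (Metric.eball_subset_eball le_radius)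

end PowerSeries

section Series

theorem norm_le_of_tsum_norm_le {ι E : Type*} [SeminormedAddCommGroup E] {f : ι → E} {C : ℝ}
    (hs : Summable fun a => ‖f a‖) (hC : ∑' a, ‖f a‖ ≤ C) (a : ι) : ‖f a‖ ≤ C :=
  (hs.le_tsum a fun _ _ => norm_nonneg _).trans hC

theorem exists_forall_norm_tsum_sub_sum_range_lt {ι : Type*} {E : ι → Type*}
    [∀ i, NormedAddCommGroup (E i)] [∀ i, CompleteSpace (E i)] {f : ∀ i, ℕ → E i} {u : ℕ → ℝ}
    (hu : Summable u) (hf : ∀ i d, ‖f i d‖ ≤ u d) {η : ℝ} (hη : 0 < η) :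
    ∃ N₀, ∀ N ≥ N₀, ∀ i, ‖∑' d, f i d - ∑ d ∈ range N, f i d‖ < η := by
  obtain ⟨N₀, tail_lt⟩ := Filter.eventually_atTop.1
    ((tendsto_sum_nat_add u).eventually_lt_const hη)
  refine ⟨N₀, fun N hN i => ?_⟩
  have hfi : Summable (f i) := hu.of_norm_bounded (hf i)
  rw [← hfi.sum_add_tsum_nat_add N, add_sub_cancel_left]
  exact (tsum_of_norm_bounded ((summable_nat_add_iff N).2 hu).hasSum
    fun d => hf i (d + N)).trans_lt (tail_lt N hN)

end Series

section ComplexificationSeries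

variable {A E : Type*} [CStarAlgebra A] [PartialOrder A] [StarOrderedRing A]
  [NormedAddCommGroup E] [NormedSpace ℂ E] {R : Submodule ℝ A}

theorem IsComplexification.norm_le_half_pow {d : ℕ} {h : R → E} {H : cspan R → E}
    (hH : IsComplexification d h H) (hR : IsRealOperatorSystem R)
    (hb : ∀ x : R, 0 ≤ (x : A) → ‖x‖ ≤ 1 → ‖h x‖ ≤ 1) {z : cspan R}
    (hz : ‖z‖ < (16 * Real.exp 1)⁻¹) : ‖H z‖ ≤ (1 / 2) ^ d := by
  obtain ⟨M, hM, hHM⟩ := hH.exists_continuousMultilinearMap hR hb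
  rw [hHM]
  exact norm_apply_diagonal_le_half_pow (by positivity) hM (hz.trans_eq (by ring))

theorem IsComplexification.analyticOnNhd_tsum [CompleteSpace E] {h : ℕ → R → E}
    {H : ℕ → cspan R → E} (hH : ∀ d, IsComplexification d (h d) (H d))
    (hR : IsRealOperatorSystem R)
    (hb : ∀ d (x : R), 0 ≤ (x : A) → ‖x‖ ≤ 1 → ‖h d x‖ ≤ 1) :
    AnalyticOnNhd ℂ (fun z => ∑' d, H d z) (Metric.ball 0 (8 * Real.exp 1)⁻¹) := by
  choose p hp hHp using fun d => (hH d).exists_continuousMultilinearMap hR (hb d)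
  simp only [hHp]
  exact analyticOnNhd_tsum_diagonal (p := p) (by positivity) hp

end ComplexificationSeries

section MatrixUniverse

variable {A B : Type*} [CStarAlgebra A] [CStarAlgebra B] {n : ℕ}

section ElementaryTensors

/-- The elementary tensor `tens` as a bilinear map. -/
def tensₗ (A : Type*) [CStarAlgebra A] (n : ℕ) :
    Matrix (Fin n) (Fin n) ℂ →ₗ[ℂ] A →ₗ[ℂ] CStarMatrix (Fin n) (Fin n) A :=
  LinearMap.mk₂ ℂ tens (fun _ _ _ => by ext; simp [tens, add_smul])
    (fun _ _ _ => by ext; simp [tens, mul_smul]) (fun _ _ _ => by ext; simp [tens])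
    (fun _ _ _ => by ext; exact smul_comm _ _ _)

theorem tensₗ_apply (T : Matrix (Fin n) (Fin n) ℂ) (a : A) : tensₗ A n T a = tens T a := rfl

theorem eq_sum_tens_single (Z : CStarMatrix (Fin n) (Fin n) A) :
    Z = ∑ i, ∑ j, tens (Matrix.single i j 1) (Z i j) := by
  refine (Matrix.matrix_eq_sum_single (CStarMatrix.ofMatrix.symm Z)).trans ?_
  refine sum_congr rfl fun i _ => sum_congr rfl fun j _ => ?_
  ext a b
  simp [tens, Matrix.single_apply, ite_smul]

theorem matUniv_le_span_tens (R : Submodule ℝ A) (n : ℕ) :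
    matUniv R n ≤ Submodule.span ℂ (Set.image2 tens Set.univ (R : Set A)) := by
  intro Z hZ
  rw [eq_sum_tens_single Z]
  refine Submodule.sum_mem _ fun i _ => Submodule.sum_mem _ fun j _ => ?_
  have cspan_le_comap : cspan R ≤ (Submodule.span ℂ (Set.image2 tens Set.univ (R : Set A))).comap
      (tensₗ A n (Matrix.single i j 1)) :=
    Submodule.span_le.2 fun x hx =>
      Submodule.subset_span (Set.mem_image2_of_mem (Set.mem_univ _) hx)
  exact cspan_le_comap (hZ i j)

theorem exists_eq_sum_tens {R : Submodule ℝ A} {Z : CStarMatrix (Fin n) (Fin n) A}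
    (hZ : Z ∈ matUniv R n) :
    ∃ (m : ℕ) (T : Fin m → Matrix (Fin n) (Fin n) ℂ) (x : Fin m → A),
      (∀ q, x q ∈ R) ∧ Z = ∑ q, tens (T q) (x q) := by
  obtain ⟨m, c, X, rfl⟩ := Submodule.mem_span_set'.1 (matUniv_le_span_tens R n hZ)
  choose T _ x hx hTx using fun q => (X q).2
  refine ⟨m, fun q => c q • T q, x, hx, sum_congr rfl fun q _ => ?_⟩
  rw [← tensₗ_apply, map_smul, LinearMap.smul_apply, tensₗ_apply, hTx]

end ElementaryTensors

theorem IsNCGenHomPoly.isGenHomPoly {R₁ : Submodule ℝ A} {R₂ : Submodule ℝ B} {d : ℕ}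
    {h : ∀ n : ℕ, CStarMatrix (Fin n) (Fin n) A → CStarMatrix (Fin n) (Fin n) B}
    (hh : IsNCGenHomPoly R₁ R₂ d h) (n : ℕ) :
    IsGenHomPoly ℂ d fun Z : matUniv R₁ n => h n Z := by
  refine .of_exists_multilinearMap fun k Z => ?_
  choose m T x hx hZ using fun i => exists_eq_sum_tens (Z i).2
  let e : (Σ i, Fin (m i)) ≃ Fin (∑ i, m i) := finSigmaFinEquiv
  let i (q : Fin (∑ i, m i)) : Fin k := (e.symm q).1
  let T' (q : Fin (∑ i, m i)) := T (i q) (e.symm q).2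
  let x' (q : Fin (∑ i, m i)) := x (i q) (e.symm q).2
  obtain ⟨C, -, hC⟩ := hh.poly _ x' fun q => hx _ _
  let wordMap (w : Fin d → Fin (∑ i, m i)) :
      MultilinearMap ℂ (fun _ : Fin d => Fin k → ℂ) (CStarMatrix (Fin n) (Fin n) B) :=
    ((tensₗ B n).flip (C w)).compMultilinearMap
      ((MultilinearMap.mkPiAlgebraFin ℂ d (Matrix (Fin n) (Fin n) ℂ)).compLinearMap fun j =>
        (LinearMap.proj (i (w j))).smulRight (T' (w j)))
  refine ⟨∑ w, wordMap w, fun t => ?_⟩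
  have sum_smul_eq : ((∑ i, t i • Z i : matUniv R₁ n) : CStarMatrix (Fin n) (Fin n) A) =
      ∑ q, tens (t (i q) • T' q) (x' q) := by
    have := Equiv.sum_comp e.symm fun q => tens (t q.1 • T q.1 q.2) (x q.1 q.2)
    rw [this, Fintype.sum_sigma]
    simp only [Submodule.coe_sum, Submodule.coe_smul, ← tensₗ_apply, map_smul,
      LinearMap.smul_apply, ← smul_sum]
    exact sum_congr rfl fun i _ => congrArg _ (hZ i)
  rw [sum_smul_eq, hC, _root_.sum_apply]
  rfl

section HermitianPart

variable {R : Submodule ℝ A}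

/-- The self-adjoint elements of the level `n` of the matrix universe over `R`. -/
def hermPart (R : Submodule ℝ A) (n : ℕ) : Submodule ℝ (CStarMatrix (Fin n) (Fin n) A) :=
  (matUniv R n).restrictScalars ℝ ⊓ selfAdjoint.submodule ℝ _

theorem star_mem_cspan (hR : R ≤ selfAdjoint.submodule ℝ A) {z : A} (hz : z ∈ cspan R) :
    star z ∈ cspan R := by
  induction hz using Submodule.span_induction with
  | mem x hx => exact (IsSelfAdjoint.star_eq (hR hx)).symm ▸ mem_cspan_of_mem hx
  | zero => simp
  | add x y _ _ hx hy => exact star_add x y ▸ (cspan R).add_mem hx hy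
  | smul c x _ hx => exact star_smul c x ▸ (cspan R).smul_mem _ hx

theorem star_mem_matUniv (hR : R ≤ selfAdjoint.submodule ℝ A)
    {X : CStarMatrix (Fin n) (Fin n) A} (hX : X ∈ matUniv R n) : star X ∈ matUniv R n :=
  fun i j => star_mem_cspan hR (hX j i)

variable [PartialOrder A] [StarOrderedRing A]

theorem cspan_hermPart (hR : R ≤ selfAdjoint.submodule ℝ A) :
    cspan (hermPart R n) = matUniv R n := by
  refine le_antisymm (Submodule.span_le.2 fun X hX => hX.1) fun X hX => ?_
  have hX' := star_mem_matUniv hR hX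
  refine (mem_cspan_iff (R := hermPart R n) inf_le_right).2 ⟨⟨?_, (ℜ X).2⟩, ⟨?_, (ℑ X).2⟩⟩
  · rw [realPart_apply_coe]
    exact (matUniv R n).smul_of_tower_mem _ ((matUniv R n).add_mem hX hX')
  · rw [imaginaryPart_apply_coe]
    exact (matUniv R n).smul_mem _
      ((matUniv R n).smul_of_tower_mem _ ((matUniv R n).sub_mem hX hX'))

theorem IsRealOperatorSystem.hermPart (hR : IsRealOperatorSystem R) (n : ℕ) :
    IsRealOperatorSystem (hermPart R n) where
  one_mem := by
    refine ⟨fun i j => ?_, .one _⟩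
    rw [CStarMatrix.one_apply]
    split_ifs
    · exact mem_cspan_of_mem hR.one_mem
    · exact (cspan R).zero_mem
  isSelfAdjoint _ hX := hX.2

end HermitianPart

section Closure

theorem cspan_mono {E : Type*} [NormedAddCommGroup E] [NormedSpace ℂ E] {R S : Submodule ℝ E}
    (h : R ≤ S) : cspan R ≤ cspan S :=
  Submodule.span_mono h

variable {R : Submodule ℝ A}

theorem topologicalClosure_le_selfAdjoint (hR : R ≤ selfAdjoint.submodule ℝ A) :
    R.topologicalClosure ≤ selfAdjoint.submodule ℝ A :=
  R.topologicalClosure_minimal hR (isClosed_eq continuous_star continuous_id)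

theorem isClosed_cspan (hR : R ≤ selfAdjoint.submodule ℝ A) (hc : IsClosed (R : Set A)) :
    IsClosed (cspan R : Set A) := by
  have continuous_re : Continuous fun z : A => (ℜ z : A) := by
    simp only [realPart_apply_coe]; fun_prop
  have continuous_im : Continuous fun z : A => (ℑ z : A) := by
    simp only [imaginaryPart_apply_coe]; fun_prop
  have cspan_eq : (cspan R : Set A) = {z | (ℜ z : A) ∈ R} ∩ {z | (ℑ z : A) ∈ R} :=
    Set.ext fun z => mem_cspan_iff hR
  rw [cspan_eq]
  exact (hc.preimage continuous_re).inter (hc.preimage continuous_im)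

end Closure

section FreeSeries

variable {ι : Type*}

theorem hasSum_iff_forall_entry {f : ι → CStarMatrix (Fin n) (Fin n) A}
    {X : CStarMatrix (Fin n) (Fin n) A} :
    HasSum f X ↔ ∀ i j, HasSum (fun a => f a i j) (X i j) :=
  Pi.hasSum.trans (forall_congr' fun _ => Pi.hasSum)

theorem hasSum_dsum {m : ℕ} {f : ι → CStarMatrix (Fin m) (Fin m) A}
    {g : ι → CStarMatrix (Fin n) (Fin n) A} {X : CStarMatrix (Fin m) (Fin m) A}
    {Y : CStarMatrix (Fin n) (Fin n) A} (hf : HasSum f X) (hg : HasSum g Y) :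
    HasSum (fun a => dsum (f a) (g a)) (dsum X Y) := by
  rw [hasSum_iff_forall_entry] at hf hg ⊢
  refine Fin.addCases (fun i => ?_) fun i => ?_ <;> refine Fin.addCases (fun j => ?_) fun j => ?_
  · simpa [dsum] using hf i j
  · simp [dsum]
  · simp [dsum]
  · simpa [dsum] using hg i j

theorem hasSum_conj [PartialOrder A] [StarOrderedRing A]
    {f : ι → CStarMatrix (Fin n) (Fin n) A} {X : CStarMatrix (Fin n) (Fin n) A}
    (hf : HasSum f X) (S : GL (Fin n) ℂ) : HasSum (fun a => conj S (f a)) (conj S X) :=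
  (hf.mul_left _).mul_right _

theorem isFreeFunction_tsum [PartialOrder B] [StarOrderedRing B] {R₁ : Submodule ℝ A}
    {R₂ : Submodule ℝ B}
    {h : ι → ∀ n : ℕ, CStarMatrix (Fin n) (Fin n) A → CStarMatrix (Fin n) (Fin n) B}
    {G : ∀ n : ℕ, Set (CStarMatrix (Fin n) (Fin n) A)} (hR₂ : R₂ ≤ selfAdjoint.submodule ℝ B)
    (hh : ∀ a, IsFreeFunction R₁ R₂ (fun n => (matUniv R₁ n : Set _)) (h a))
    (hG : ∀ n, ∀ X ∈ G n, X ∈ matUniv R₁ n) (hs : ∀ n, ∀ X ∈ G n, Summable fun a => h a n X) :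
    IsFreeFunction R₁ R₂.topologicalClosure G fun n Z => ∑' a, h a n Z where
  domain_subset := hG
  maps_to n X hX i j := by
    rw [← (hasSum_iff_forall_entry.1 (hs n X hX).hasSum i j).tsum_eq]
    exact tsum_mem (isClosed_cspan (topologicalClosure_le_selfAdjoint hR₂)
      R₂.isClosed_topologicalClosure) fun a =>
        cspan_mono R₂.le_topologicalClosure ((hh a).maps_to n X (hG n X hX) i j)
  map_dsum m n X hX Y hY hXY := by
    refine HasSum.tsum_eq ?_
    simp only [(hh _).map_dsum m n X (hG m X hX) Y (hG n Y hY) (hG _ _ hXY)]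
    exact hasSum_dsum (hs m X hX).hasSum (hs n Y hY).hasSum
  map_conj n X hX S hSX := by
    refine HasSum.tsum_eq ?_
    simp only [(hh _).map_conj n X (hG n X hX) S (hG _ _ hSX)]
    exact hasSum_conj (hs n X hX).hasSum S

end FreeSeries

section Level

variable [PartialOrder A] [StarOrderedRing A] [PartialOrder B] [StarOrderedRing B]
  {R₁ : Submodule ℝ A} {R₂ : Submodule ℝ B}

theorem IsNCGenHomPoly.exists_continuousMultilinearMap {d : ℕ}
    {h : ∀ n : ℕ, CStarMatrix (Fin n) (Fin n) A → CStarMatrix (Fin n) (Fin n) B}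
    (hh : IsNCGenHomPoly R₁ R₂ d h) (hR₁ : IsRealOperatorSystem R₁)
    (hb : ∀ X ∈ ncPosContractions R₁ n, ‖h n X‖ ≤ 1) :
    ∃ M : ContinuousMultilinearMap ℂ (fun _ : Fin d => matUniv R₁ n)
        (CStarMatrix (Fin n) (Fin n) B),
      ‖M‖ ≤ (8 * Real.exp 1) ^ d ∧ ∀ Z : matUniv R₁ n, h n Z = M fun _ => Z :=
  exists_continuousMultilinearMap_of_cspan_eq (hR₁.hermPart n)
    (cspan_hermPart hR₁.le_selfAdjoint) (hh.isGenHomPoly n)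
    fun X _ h0 h1 => hb X ⟨X.2, h0, h1⟩

theorem IsNCGenHomPoly.norm_le_half_pow {d : ℕ}
    {h : ∀ n : ℕ, CStarMatrix (Fin n) (Fin n) A → CStarMatrix (Fin n) (Fin n) B}
    (hh : IsNCGenHomPoly R₁ R₂ d h) (hR₁ : IsRealOperatorSystem R₁)
    (hb : ∀ X ∈ ncPosContractions R₁ n, ‖h n X‖ ≤ 1) {Z : CStarMatrix (Fin n) (Fin n) A}
    (hZ : Z ∈ ncBall R₁ (16 * Real.exp 1)⁻¹ n) : ‖h n Z‖ ≤ (1 / 2) ^ d := by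
  obtain ⟨M, hM, hhM⟩ := hh.exists_continuousMultilinearMap hR₁ hb
  rw [hhM ⟨Z, hZ.1⟩]
  exact norm_apply_diagonal_le_half_pow (by positivity) hM (hZ.2.trans_eq (by ring))

theorem IsNCGenHomPoly.analyticOnNhd_tsum
    {h : ℕ → ∀ n : ℕ, CStarMatrix (Fin n) (Fin n) A → CStarMatrix (Fin n) (Fin n) B}
    (hh : ∀ d, IsNCGenHomPoly R₁ R₂ d (h d)) (hR₁ : IsRealOperatorSystem R₁)
    (hb : ∀ d, ∀ X ∈ ncPosContractions R₁ n, ‖h d n X‖ ≤ 1) :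
    AnalyticOnNhd ℂ (fun Z : matUniv R₁ n => ∑' d, h d n Z)
      (Metric.ball 0 (8 * Real.exp 1)⁻¹) := by
  choose p hp hhp using fun d => (hh d).exists_continuousMultilinearMap hR₁ (hb d)
  simp only [hhp]
  exact analyticOnNhd_tsum_diagonal (p := p) (by positivity) hp

end Level

end MatrixUniverse

end WedgeOfEdge

end

open WedgeOfEdge in
theorem mainTheorem9_general :
    ∃ δ ε : ℝ, 0 < δ ∧ 0 < ε ∧
      (∀ (A : Type*) [CStarAlgebra A] [PartialOrder A] [StarOrderedRing A]
        (E : Type*) [NormedAddCommGroup E] [NormedSpace ℂ E] [CompleteSpace E]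
        (R₁ : Submodule ℝ A) (R₂ : Submodule ℝ E), IsRealOperatorSystem R₁ →
        ∀ h : ℕ → R₁ → E,
          (∀ d, IsGenHomPoly ℝ d (h d)) → (∀ d x, h d x ∈ R₂) →
          (∀ d (x : R₁), 0 ≤ (x : A) → ‖x‖ ≤ 1 → ‖h d x‖ ≤ 1) →
          (∀ d, ∃! H : cspan R₁ → E, IsComplexification d (h d) H) ∧
          ∀ H : ℕ → cspan R₁ → E, (∀ d, IsComplexification d (h d) (H d)) →
            (∀ Z ∈ Metric.ball (0 : cspan R₁) δ, Summable fun d => ‖H d Z‖) ∧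
            TendstoUniformlyOn (fun N Z => ∑ d ∈ Finset.range N, H d Z) (fun Z => ∑' d, H d Z)
              Filter.atTop (Metric.ball (0 : cspan R₁) δ) ∧
            AnalyticOnNhd ℂ (fun Z => ∑' d, H d Z) (Metric.ball (0 : cspan R₁) δ) ∧
            ∀ Z ∈ Metric.ball (0 : cspan R₁) δ,
              ∑' d, H d Z ∈ (cspan R₂).topologicalClosure ∧ ‖∑' d, H d Z‖ ≤ ε) ∧
      (∀ (A : Type*) [CStarAlgebra A] [PartialOrder A] [StarOrderedRing A]
        (B : Type*) [CStarAlgebra B] [PartialOrder B] [StarOrderedRing B]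
        (R₁ : Submodule ℝ A) (R₂ : Submodule ℝ B),
        IsRealOperatorSystem R₁ → R₂ ≤ selfAdjoint.submodule ℝ B →
        ∀ h : ℕ → ∀ n : ℕ, CStarMatrix (Fin n) (Fin n) A → CStarMatrix (Fin n) (Fin n) B,
          (∀ d, IsNCGenHomPoly R₁ R₂ d (h d)) →
          (∀ d n, ∀ X ∈ ncPosContractions R₁ n, ‖h d n X‖ ≤ 1) →
          (∀ n, ∀ Z ∈ ncBall R₁ δ n, Summable fun d => ‖h d n Z‖) ∧
          (∀ η : ℝ, 0 < η → ∃ N₀ : ℕ, ∀ N ≥ N₀, ∀ n, ∀ Z ∈ ncBall R₁ δ n,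
            ‖(∑' d, h d n Z) - ∑ d ∈ Finset.range N, h d n Z‖ < η) ∧
          IsNCAnalytic R₁ R₂.topologicalClosure (ncBall R₁ δ) (fun n Z => ∑' d, h d n Z) ∧
          ∀ n, ∀ Z ∈ ncBall R₁ δ n, ‖∑' d, h d n Z‖ ≤ ε) := by
  have radius_le : (16 * Real.exp 1)⁻¹ ≤ (8 * Real.exp 1)⁻¹ := by gcongr; norm_num
  refine ⟨(16 * Real.exp 1)⁻¹, 2, by positivity, two_pos, ?_, ?_⟩
  · intro A _ _ _ E _ _ _ R₁ R₂ hR₁ h hh hR₂ hb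
    have hR₁' := hR₁.le_selfAdjoint
    refine ⟨fun d => (hh d).existsUnique_isComplexification hR₁', fun H hH => ?_⟩
    have bound (d) (Z) (hZ : Z ∈ Metric.ball 0 (16 * Real.exp 1)⁻¹) : ‖H d Z‖ ≤ (1 / 2) ^ d :=
      (hH d).norm_le_half_pow hR₁ (hb d) (mem_ball_zero_iff.1 hZ)
    exact ⟨fun Z hZ =>
        summable_geometric_two.of_nonneg_of_le (fun _ => norm_nonneg _) (bound · Z hZ),
      tendstoUniformlyOn_tsum_nat summable_geometric_two bound,
      (IsComplexification.analyticOnNhd_tsum hH hR₁ hb).mono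
        (Metric.ball_subset_ball radius_le),
      fun Z hZ => ⟨tsum_mem (cspan R₂).isClosed_topologicalClosure fun d =>
        (cspan R₂).le_topologicalClosure ((hH d).mem_of_forall_mem hR₁' (hR₂ d) Z),
        tsum_of_norm_bounded hasSum_geometric_two (bound · Z hZ)⟩⟩
  · intro A _ _ _ B _ _ _ R₁ R₂ hR₁ hR₂ h hh hb
    have bound (n) (Z) (hZ : Z ∈ ncBall R₁ (16 * Real.exp 1)⁻¹ n) (d) : ‖h d n Z‖ ≤ (1 / 2) ^ d :=
      (hh d).norm_le_half_pow hR₁ (hb d n) hZ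
    have summable_norm (n) (Z) (hZ : Z ∈ ncBall R₁ (16 * Real.exp 1)⁻¹ n) :
        Summable fun d => ‖h d n Z‖ :=
      summable_geometric_two.of_nonneg_of_le (fun _ => norm_nonneg _) (bound n Z hZ)
    refine ⟨summable_norm, fun η hη => ?_,
      ⟨isFreeFunction_tsum hR₂ (fun d => (hh d).free) (fun n Z hZ => hZ.1)
          fun n Z hZ => (summable_norm n Z hZ).of_norm,
        fun n => (IsNCGenHomPoly.analyticOnNhd_tsum hh hR₁ fun d => hb d n).mono
          fun Z hZ => mem_ball_zero_iff.2 (hZ.2.trans_le radius_le)⟩,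
      fun n Z hZ => tsum_of_norm_bounded hasSum_geometric_two (bound n Z hZ)⟩
    obtain ⟨N₀, hN₀⟩ := exists_forall_norm_tsum_sub_sum_range_lt summable_geometric_two
      (fun i : Σ n, ncBall R₁ (16 * Real.exp 1)⁻¹ n => bound i.1 i.2 i.2.2) hη
    exact ⟨N₀, fun N hN n Z hZ => hN₀ N hN ⟨n, Z, hZ⟩⟩

open WedgeOfEdge in
theorem mainTheorem9 :
    ∃ δ ε : ℝ, 0 < δ ∧ 0 < ε ∧
      -- the commutative case
      (∀ (A : Type*) [CStarAlgebra A] [PartialOrder A] [StarOrderedRing A]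
        (E : Type*) [NormedAddCommGroup E] [NormedSpace ℂ E] [CompleteSpace E]
        (R₁ : Submodule ℝ A) (R₂ : Submodule ℝ E), IsRealOperatorSystem R₁ →
        ∀ h : ℕ → R₁ → E,
          (∀ d, IsGenHomPoly ℝ d (h d)) → (∀ d x, h d x ∈ R₂) →
          (∀ x : R₁, 0 ≤ (x : A) → ‖x‖ ≤ 1 →
            Summable (fun d => ‖h d x‖) ∧ ∑' d, ‖h d x‖ ≤ 1) →
          (∀ d, ∃! H : cspan R₁ → E, IsComplexification d (h d) H) ∧
          ∀ H : ℕ → cspan R₁ → E, (∀ d, IsComplexification d (h d) (H d)) →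
            (∀ Z ∈ Metric.ball (0 : cspan R₁) δ, Summable fun d => ‖H d Z‖) ∧
            TendstoUniformlyOn (fun N Z => ∑ d ∈ Finset.range N, H d Z) (fun Z => ∑' d, H d Z)
              Filter.atTop (Metric.ball (0 : cspan R₁) δ) ∧
            AnalyticOnNhd ℂ (fun Z => ∑' d, H d Z) (Metric.ball (0 : cspan R₁) δ) ∧
            ∀ Z ∈ Metric.ball (0 : cspan R₁) δ,
              ∑' d, H d Z ∈ (cspan R₂).topologicalClosure ∧ ‖∑' d, H d Z‖ ≤ ε) ∧
      -- the noncommutative case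
      (∀ (A : Type*) [CStarAlgebra A] [PartialOrder A] [StarOrderedRing A]
        (B : Type*) [CStarAlgebra B] [PartialOrder B] [StarOrderedRing B]
        (R₁ : Submodule ℝ A) (R₂ : Submodule ℝ B),
        IsRealOperatorSystem R₁ → IsRealOperatorSystem R₂ →
        ∀ h : ℕ → ∀ n : ℕ, CStarMatrix (Fin n) (Fin n) A → CStarMatrix (Fin n) (Fin n) B,
          (∀ d, IsNCGenHomPoly R₁ R₂ d (h d)) →
          (∀ n, ∀ X ∈ ncPosContractions R₁ n,
            Summable (fun d => ‖h d n X‖) ∧ ∑' d, ‖h d n X‖ ≤ 1) →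
          (∀ n, ∀ Z ∈ ncBall R₁ δ n, Summable fun d => ‖h d n Z‖) ∧
          (∀ η : ℝ, 0 < η → ∃ N₀ : ℕ, ∀ N ≥ N₀, ∀ n, ∀ Z ∈ ncBall R₁ δ n,
            ‖(∑' d, h d n Z) - ∑ d ∈ Finset.range N, h d n Z‖ < η) ∧
          IsNCAnalytic R₁ R₂.topologicalClosure (ncBall R₁ δ) (fun n Z => ∑' d, h d n Z) ∧
          ∀ n, ∀ Z ∈ ncBall R₁ δ n, ‖∑' d, h d n Z‖ ≤ ε) := by
  obtain ⟨δ, ε, hδ, hε, commutative, noncommutative⟩ := mainTheorem9_general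
  refine ⟨δ, ε, hδ, hε, ?_, ?_⟩
  · exact fun A _ _ _ E _ _ _ R₁ R₂ hR₁ h hh hhR₂ hsum =>
      commutative A E R₁ R₂ hR₁ h hh hhR₂ fun d x h0 h1 =>
        norm_le_of_tsum_norm_le (hsum x h0 h1).1 (hsum x h0 h1).2 d
  · exact fun A _ _ _ B _ _ _ R₁ R₂ hR₁ hR₂ h hh hsum =>
      noncommutative A B R₁ R₂ hR₁ hR₂.le_selfAdjoint h hh fun d n X hX =>
        norm_le_of_tsum_norm_le (hsum n X hX).1 (hsum n X hX).2 d
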